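/- Let $M$ be a (finite-dimensional, boundaryless, Hausdorff) smooth Riemannian manifold, let $f : M \to [0,\infty)$ be a continuous function, put $\Sigma = f^{-1}(0)$, and let $a > 0$. Assume that $f$ is $C^2$ on $M \setminus \Sigma$, that there is a constant $\alpha > 0$ with $\|\nabla f(x)\| > \alpha$ for all $x \in M \setminus \Sigma$, and that $f^{-1}([0,a])$ is compact. Then $\Sigma$ is a strong deformation retract of $f^{-1}([0,a])$, and $f^{-1}([a,\infty))$ is a strong deformation retract of $M \setminus \Sigma$. Here, for subsets $A \subseteq Y$ of $M$, $A$ is a strong deformation retract of $Y$ if there is a continuous map $H : [0,1] \times Y \to Y$ with $H(0,y) = y$ and $H(1,y) \in A$ for all $y \in Y$, and $H(t,y) = y$ for all $y \in A$ and $t \in [0,1]$. -/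

import Mathlib

open scoped Manifold ContDiff Bundle

/-- `A` is a strong deformation retract of `Y` (both subsets of a topological space, with the
subspace topologies): `A ⊆ Y`, and the identity of `Y` is homotopic, relative to `A`, to a
continuous map `r : Y → Y` with values in `A`. -/
def IsStrongDeformationRetract {X : Type*} [TopologicalSpace X] (A Y : Set X) : Prop :=
  A ⊆ Y ∧ ∃ r : C(Y, Y), (∀ y : Y, (r y : X) ∈ A) ∧
    (ContinuousMap.id Y).HomotopicRel r {y : Y | (y : X) ∈ A}

section Gradient

variable {E : Type*} [NormedAddCommGroup E] [NormedSpace ℝ E] [FiniteDimensional ℝ E]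
  {M : Type*} [TopologicalSpace M] [ChartedSpace E M]
  [Bundle.RiemannianBundle (fun x : M => TangentSpace 𝓘(ℝ, E) x)]

instance finiteDimensional_tangent (x : M) :
    FiniteDimensional ℝ (TangentSpace 𝓘(ℝ, E) x) :=
  inferInstanceAs (FiniteDimensional ℝ E)

/-- The Riemannian gradient `∇ f (x) ∈ T_x M`: the vector that represents the differential of `f`
at `x` with respect to the Riemannian inner product of `T_x M`. -/
noncomputable def riemannianGradient (f : M → ℝ) (x : M) : TangentSpace 𝓘(ℝ, E) x :=
  haveI : CompleteSpace (TangentSpace 𝓘(ℝ, E) x) := FiniteDimensional.complete ℝ _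
  (InnerProductSpace.toDual ℝ (TangentSpace 𝓘(ℝ, E) x)).symm
    (mvfderiv 𝓘(ℝ, E) f x)

/-- The defining property of the gradient. -/
theorem inner_riemannianGradient (f : M → ℝ) (x : M) (v : TangentSpace 𝓘(ℝ, E) x) :
    inner ℝ (riemannianGradient f x) v = mvfderiv 𝓘(ℝ, E) f x v := by
  have : CompleteSpace (TangentSpace 𝓘(ℝ, E) x) := FiniteDimensional.complete ℝ _
  exact InnerProductSpace.toDual_symm_apply

end Gradient

/-!
The retractions are usually obtained from the flow of `∓ ∇ f / ‖∇ f‖ ^ 2`. They only have to be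
continuous, and no uniqueness or semigroup property is needed, so the flow can be replaced by
finite compositions of local moves.

Near a point `p` with `f p > 0`, read `f` in a chart and let `v = ∇ f / ‖∇ f‖ ^ 2` at `p`. The
inverse function theorem gives coordinates, tangent to the identity at `p`, in which `f` is affine
with slope `1` along `v`. Moving along `v` in these coordinates changes `f` by any prescribed
small `τ`; as `‖v‖ < 1 / α` and the metric is continuous, this moves points near `p` by at most
`|τ| / α` (`exists_isLevelPush_of_lt_norm_riemannianGradient`). The constant `1 / α` does not
depend on `p`.

On a compact set, the local moves are composed, each by the fraction of `τ` that a partition of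
unity prescribes (`exists_isLevelPush_of_isCompact`). Repeating a move by a fixed maximal amount
finitely many times carries each point of `b ≤ f ≤ a`, where `b > 0`, to any level in `[b, a]`
(`IsLevelPush.exists_isLevelTransport`), still by at most `1 / α` times the change of `f`.

Letting `b = a / 2 ^ n` tend to `0`: downwards, the successive positions of a point form a uniformly
Cauchy sequence thanks to the bound on distances, and their limit is the deformation of `f ≤ a`
onto the zero set (`exists_lowering_to_zero`). Upwards, a point with `f > 0` only meets finitely
many of the levels `a / 2 ^ n`, and the transports between them are concatenated
(`exists_raising`).
-/

open Set Filter Topology Function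

/-! ### Local moves and transport between positive levels -/

section EMetric

variable {X : Type*} [EMetricSpace X]

/-- `P x τ` moves the points `x` of `S` so as to change the value of `f` by exactly `τ ∈ [-r, r]`,
continuously in `(x, τ)` and by a distance at most `L * |τ|`. -/
structure IsLevelPush (f : X → ℝ) (L : ℝ) (S : Set X) (r : ℝ) (P : X → ℝ → X) : Prop where
  continuousOn : ContinuousOn (uncurry P) (S ×ˢ Icc (-r) r)
  apply_eq : ∀ x ∈ S, ∀ τ ∈ Icc (-r) r, f (P x τ) = f x + τ
  edist_le : ∀ x ∈ S, ∀ τ ∈ Icc (-r) r, edist x (P x τ) ≤ ENNReal.ofReal (L * |τ|)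

/-- Local pushes combine to a push on a compact set: with a partition of unity `ρ` subordinate to
their domains, apply them one after the other, the one around `p` by the amount `ρ p x * τ`. For
small `τ` the intermediate points stay in the domains, and the distances add up to `L * |τ|`. -/
theorem exists_isLevelPush_of_isCompact {f : X → ℝ} {L : ℝ} (hL : 0 ≤ L) {K : Set X}
    (hK : IsCompact K)
    (hloc : ∀ p ∈ K, ∃ r > 0, ∃ P, IsLevelPush f L (Metric.eball p (ENNReal.ofReal r)) r P) :
    ∃ δ > 0, ∃ P, IsLevelPush f L K δ P := by
  classical
  choose! R hR P hP using hloc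
  obtain ⟨t, htK, htc⟩ := hK.elim_nhds_subcover
    (fun p => Metric.eball p (ENNReal.ofReal (R p / 2)))
    (fun p hp => Metric.eball_mem_nhds _ (by simpa using hR p hp))
  obtain ⟨ρ, hρ⟩ := PartitionOfUnity.exists_isSubordinate hK.isClosed
    (fun p : t => Metric.eball (p : X) (ENNReal.ofReal (R p / 2)))
    (fun p => Metric.isOpen_eball) (by simpa [iUnion_subtype] using htc)
  -- The supports lie in balls of half the radius, so that the other half is left for the moves.
  obtain ⟨δ, hδ0, hδ⟩ : ∃ δ : ℝ, 0 < δ ∧ ∀ p ∈ t, δ < R p ∧ L * δ < R p / 2 := by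
    have h1 : ∀ᶠ δ : ℝ in 𝓝[>] 0, ∀ p ∈ t, δ < R p ∧ L * δ < R p / 2 := by
      refine (Filter.eventually_all_finset t).2 fun p hp => ?_
      have hRp := hR p (htK p hp)
      refine nhdsWithin_le_nhds (Filter.Eventually.and ?_ ?_)
      · exact eventually_lt_nhds hRp
      · have : Tendsto (fun δ : ℝ => L * δ) (𝓝 0) (𝓝 (L * 0)) := tendsto_id.const_mul L
        rw [mul_zero] at this
        exact this.eventually_lt_const (by linarith)
    obtain ⟨δ, h, h'⟩ := (h1.and self_mem_nhdsWithin).exists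
    exact ⟨δ, h', h⟩
  have hnn : ∀ (p : t) (x : X), 0 ≤ ρ p x := fun p x => ρ.nonneg p x
  have hle : ∀ (s : Finset t), ∀ x ∈ K, ∑ p ∈ s, ρ p x ≤ 1 := by
    intro s x hx
    have h1 := ρ.sum_eq_one hx
    rw [finsum_eq_sum_of_fintype] at h1
    rw [← h1]
    exact Finset.sum_le_sum_of_subset_of_nonneg (Finset.subset_univ s) fun p _ _ => hnn p x
  -- Induct on the set of local pushes already applied. The fractions always refer to the initial
  -- point `x`, so their sum is `1` in the end.
  have key : ∀ s : Finset t, ∃ Q : X → ℝ → X, ContinuousOn (uncurry Q) (K ×ˢ Icc (-δ) δ) ∧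
      ∀ x ∈ K, ∀ τ ∈ Icc (-δ) δ, f (Q x τ) = f x + (∑ p ∈ s, ρ p x) * τ ∧
        edist x (Q x τ) ≤ ENNReal.ofReal (L * ((∑ p ∈ s, ρ p x) * |τ|)) := by
    intro s
    induction s using Finset.induction_on with
    | empty => exact ⟨fun x _ => x, continuous_fst.continuousOn, by simp⟩
    | insert p s hps ih =>
      obtain ⟨Q, hQc, hQ⟩ := ih
      have hPp := hP p (htK p p.2)
      have hδp := hδ p p.2
      -- the intermediate point lies in the domain of the local push
      have hmem : ∀ x ∈ K, ∀ τ ∈ Icc (-δ) δ, x ∈ Metric.eball (p : X) (ENNReal.ofReal (R p / 2)) →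
          Q x τ ∈ Metric.eball (p : X) (ENNReal.ofReal (R p)) := by
        intro x hx τ hτ hxp
        have h1 : edist (Q x τ) x ≤ ENNReal.ofReal (R p / 2) := by
          rw [edist_comm]
          refine ((hQ x hx τ hτ).2).trans (ENNReal.ofReal_le_ofReal ?_)
          have : (∑ p ∈ s, ρ p x) * |τ| ≤ 1 * δ :=
            mul_le_mul (hle s x hx) (abs_le.2 hτ) (abs_nonneg _) zero_le_one
          nlinarith
        rw [Metric.mem_eball] at hxp ⊢
        calc edist (Q x τ) p ≤ edist (Q x τ) x + edist x p := edist_triangle _ _ _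
          _ < ENNReal.ofReal (R p / 2) + ENNReal.ofReal (R p / 2) :=
            ENNReal.add_lt_add_of_le_of_lt (h1.trans_lt ENNReal.ofReal_lt_top).ne h1 hxp
          _ = ENNReal.ofReal (R p) := by
            rw [← ENNReal.ofReal_add (by linarith) (by linarith), add_halves]
      have hamt : ∀ x ∈ K, ∀ τ ∈ Icc (-δ) δ, ρ p x * τ ∈ Icc (-R p) (R p) := by
        intro x hx τ hτ
        rw [mem_Icc, ← abs_le, abs_mul, abs_of_nonneg (hnn p x)]
        have : ρ p x * |τ| ≤ 1 * δ :=
          mul_le_mul (ρ.le_one p x) (abs_le.2 hτ) (abs_nonneg _) zero_le_one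
        linarith
      have hsupp : ∀ x, ρ p x ≠ 0 → x ∈ Metric.eball (p : X) (ENNReal.ofReal (R p / 2)) :=
        fun x hx => hρ p (subset_tsupport _ hx)
      refine ⟨fun x τ => if ρ p x = 0 then Q x τ else P p (Q x τ) (ρ p x * τ), ?_, ?_⟩
      · -- Near the support, the second branch is valid throughout, since a push by `0` is the
        -- identity; away from it, the first branch applies.
        rintro ⟨x, τ⟩ ⟨hx, hτ⟩
        by_cases hxs : x ∈ tsupport (ρ p)
        · have hxp := hρ p hxs
          have h1 : ContinuousWithinAt (fun z : X × ℝ => P p (Q z.1 z.2) (ρ p z.1 * z.2))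
              ((K ×ˢ Icc (-δ) δ) ∩
                (Prod.fst ⁻¹' Metric.eball (p : X) (ENNReal.ofReal (R p / 2)))) (x, τ) := by
            have h2 : ContinuousOn
                (fun z : X × ℝ => ((Q z.1 z.2, ρ p z.1 * z.2) : X × ℝ)) (K ×ˢ Icc (-δ) δ) :=
              hQc.prodMk (by fun_prop)
            refine ContinuousOn.comp (g := uncurry (P p)) hPp.continuousOn
              (h2.mono inter_subset_left) ?_ (x, τ) ⟨⟨hx, hτ⟩, hxp⟩
            rintro ⟨y, σ⟩ ⟨⟨hy, hσ⟩, hyp⟩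
            exact ⟨hmem y hy σ hσ hyp, hamt y hy σ hσ⟩
          rw [continuousWithinAt_inter
            ((Metric.isOpen_eball.preimage continuous_fst).mem_nhds hxp)] at h1
          refine h1.congr_of_eventuallyEq ?_ ?_
          · have : Prod.fst ⁻¹' Metric.eball (p : X) (ENNReal.ofReal (R p / 2)) ∈
                𝓝[K ×ˢ Icc (-δ) δ] (x, τ) := mem_nhdsWithin_of_mem_nhds
              ((Metric.isOpen_eball.preimage continuous_fst).mem_nhds hxp)
            filter_upwards [this, self_mem_nhdsWithin] with z hz hz'
            by_cases h0 : ρ p z.1 = 0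
            · have h3 := hPp.edist_le _ (hmem z.1 hz'.1 z.2 hz'.2 hz) _ (hamt z.1 hz'.1 z.2 hz'.2)
              simp only [h0, zero_mul, abs_zero, mul_zero, ENNReal.ofReal_zero,
                nonpos_iff_eq_zero, edist_eq_zero] at h3
              simpa [uncurry, h0] using h3
            · simp [uncurry, h0]
          · by_cases h0 : ρ p x = 0
            · have h3 := hPp.edist_le _ (hmem x hx τ hτ hxp) _ (hamt x hx τ hτ)
              simp only [h0, zero_mul, abs_zero, mul_zero, ENNReal.ofReal_zero,
                nonpos_iff_eq_zero, edist_eq_zero] at h3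
              simpa [uncurry, h0] using h3
            · simp [uncurry, h0]
        · refine (hQc (x, τ) ⟨hx, hτ⟩).congr_of_eventuallyEq ?_ ?_
          · have : Prod.fst ⁻¹' (tsupport (ρ p))ᶜ ∈ 𝓝[K ×ˢ Icc (-δ) δ] (x, τ) :=
              mem_nhdsWithin_of_mem_nhds
                (((isClosed_tsupport _).isOpen_compl.preimage continuous_fst).mem_nhds hxs)
            filter_upwards [this] with z hz
            simp [uncurry, image_eq_zero_of_notMem_tsupport hz]
          · simp [uncurry, image_eq_zero_of_notMem_tsupport hxs]
      · intro x hx τ hτ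
        rw [Finset.sum_insert hps]
        obtain ⟨hQ1, hQ2⟩ := hQ x hx τ hτ
        by_cases h0 : ρ p x = 0
        · simpa [h0] using ⟨hQ1, hQ2⟩
        · have hm := hmem x hx τ hτ (hsupp x h0)
          have ha := hamt x hx τ hτ
          simp only [h0, if_false]
          refine ⟨by rw [hPp.apply_eq _ hm _ ha, hQ1]; ring, ?_⟩
          refine (edist_triangle _ (Q x τ) _).trans
            ((add_le_add hQ2 (hPp.edist_le _ hm _ ha)).trans_eq ?_)
          rw [← ENNReal.ofReal_add, abs_mul, abs_of_nonneg (hnn p x)]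
          · congr 1; ring
          · have := Finset.sum_nonneg fun q (_ : q ∈ s) => hnn q x
            positivity
          · positivity
  obtain ⟨Q, hQc, hQ⟩ := key Finset.univ
  have h1 : ∀ x ∈ K, ∑ p, ρ p x = 1 := fun x hx => by
    rw [← finsum_eq_sum_of_fintype]; exact ρ.sum_eq_one hx
  refine ⟨δ, hδ0, Q, hQc, fun x hx τ hτ => ?_, fun x hx τ hτ => ?_⟩
  · simpa only [h1 x hx, one_mul] using (hQ x hx τ hτ).1
  · simpa only [h1 x hx, one_mul] using (hQ x hx τ hτ).2

/-- `T x s` is a point of the level set `f = s`, for `x` with `f x ∈ [b, a]` and `s ∈ [b, a]`,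
depending continuously on `(x, s)` and at distance at most `L * |s - f x|` from `x`. -/
structure IsLevelTransport (f : X → ℝ) (L b a : ℝ) (T : X → ℝ → X) : Prop where
  continuousOn : ContinuousOn (uncurry T) ((f ⁻¹' Icc b a) ×ˢ Icc b a)
  apply_eq : ∀ x ∈ f ⁻¹' Icc b a, ∀ s ∈ Icc b a, f (T x s) = s
  edist_le : ∀ x ∈ f ⁻¹' Icc b a, ∀ s ∈ Icc b a,
    edist x (T x s) ≤ ENNReal.ofReal (L * |s - f x|)

theorem IsLevelTransport.apply_self {f : X → ℝ} {L b a : ℝ} {T : X → ℝ → X}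
    (hT : IsLevelTransport f L b a T) {x : X} (hx : f x ∈ Icc b a) : T x (f x) = x := by
  have h := hT.edist_le x hx (f x) hx
  simp only [sub_self, abs_zero, mul_zero, ENNReal.ofReal_zero, nonpos_iff_eq_zero,
    edist_eq_zero] at h
  exact h.symm

/-- Iterating a push whose amount is the missing change of `f`, truncated to `[-δ, δ]`, reaches the
target level in a number of steps that depends only on `a - b`. -/
theorem IsLevelPush.exists_isLevelTransport {f : X → ℝ} (hf : Continuous f) {L b a δ : ℝ}
    (hL : 0 ≤ L) (hδ : 0 < δ) {P : X → ℝ → X} (hP : IsLevelPush f L (f ⁻¹' Icc b a) δ P) :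
    ∃ T, IsLevelTransport f L b a T := by
  set K := f ⁻¹' Icc b a with hK
  -- Each step moves `f` towards the target by `δ`, or reaches the target.
  have key : ∀ n : ℕ, ∃ T : X → ℝ → X, ContinuousOn (uncurry T) (K ×ˢ Icc b a) ∧
      ∀ x ∈ K, ∀ s ∈ Icc b a, T x s ∈ K ∧ |s - f (T x s)| ≤ max 0 (|s - f x| - n * δ) ∧
        |s - f (T x s)| ≤ |s - f x| ∧
        edist x (T x s) ≤ ENNReal.ofReal (L * (|s - f x| - |s - f (T x s)|)) := by
    intro n
    induction n with
    | zero =>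
      refine ⟨fun x _ => x, continuous_fst.continuousOn, fun x hx s _ => ⟨hx, ?_, ?_, ?_⟩⟩ <;> simp
    | succ n ih =>
      obtain ⟨T, hTc, hT⟩ := ih
      set c : ℝ → ℝ := fun u => max (-δ) (min δ u) with hc
      have hcmem : ∀ u, c u ∈ Icc (-δ) δ := fun u =>
        ⟨le_max_left _ _, max_le (by linarith) (min_le_left _ _)⟩
      have hcabs : ∀ u, |u - c u| = |u| - |c u| ∧ |u - c u| ≤ max 0 (|u| - δ) := by
        intro u
        simp only [hc]
        rcases le_total δ u with h | h
        · rw [min_eq_left h, max_eq_right (by linarith), abs_of_nonneg (by linarith : 0 ≤ u),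
            abs_of_nonneg (by linarith : 0 ≤ u - δ), abs_of_pos hδ]
          exact ⟨rfl, le_max_right _ _⟩
        · rw [min_eq_right h]
          rcases le_total (-δ) u with h' | h'
          · rw [max_eq_right h']; simp
          · rw [max_eq_left h', abs_of_nonpos (by linarith : u ≤ 0),
              abs_of_nonpos (by linarith : u - -δ ≤ 0), abs_neg, abs_of_pos hδ]
            exact ⟨by ring, le_max_of_le_right (by linarith)⟩
      have hcc : Continuous c := by fun_prop
      refine ⟨fun x s => P (T x s) (c (s - f (T x s))), ?_, fun x hx s hs => ?_⟩
      · have h2 : ContinuousOn (fun z : X × ℝ => ((T z.1 z.2, c (z.2 - f (T z.1 z.2))) : X × ℝ))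
            (K ×ˢ Icc b a) := by
          refine hTc.prodMk (hcc.comp_continuousOn ?_)
          exact continuous_snd.continuousOn.sub (hf.comp_continuousOn hTc)
        exact ContinuousOn.comp (g := uncurry P) hP.continuousOn h2
          fun z hz => ⟨(hT z.1 hz.1 z.2 hz.2).1, hcmem _⟩
      · obtain ⟨hTK, hTn, hTle, hTd⟩ := hT x hx s hs
        set y := T x s with hy
        set u := s - f y with hu
        have hfP : f (P y (c u)) = f y + c u := hP.apply_eq y hTK _ (hcmem u)
        have hd := hP.edist_le y hTK _ (hcmem u)
        obtain ⟨h1, h2⟩ := hcabs u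
        have h3 : s - f (P y (c u)) = u - c u := by rw [hfP, hu]; ring
        have h4 : |u - c u| ≤ |u| := by rw [h1]; linarith [abs_nonneg (c u)]
        refine ⟨?_, ?_, ?_, ?_⟩
        · -- the new value of `f` lies between the old one and the target
          have h5 : f (P y (c u)) ∈ uIcc (f y) s := by
            rw [hfP]
            rcases le_total 0 u with h | h
            · have h6 : 0 ≤ c u := le_max_of_le_right (le_min hδ.le h)
              have h7 : c u ≤ u := max_le (by linarith) (min_le_right _ _)
              exact ⟨min_le_of_left_le (by linarith), le_max_of_le_right (by linarith)⟩
            · have h6 : c u ≤ 0 := max_le (by linarith) (min_le_of_right_le h)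
              have h7 : u ≤ c u := le_max_of_le_right (le_min (by linarith) le_rfl)
              exact ⟨min_le_of_right_le (by linarith), le_max_of_le_left (by linarith)⟩
          exact uIcc_subset_Icc hTK hs h5
        · rw [h3]
          refine h2.trans (max_le (le_max_left _ _) ?_)
          push_cast
          rcases max_cases 0 (|s - f x| - n * δ) with ⟨h, _⟩ | ⟨h, _⟩ <;> rw [h] at hTn
          · exact le_max_of_le_left (by linarith)
          · exact le_max_of_le_right (by linarith)
        · rw [h3]; exact h4.trans hTle
        · rw [h3]
          refine (edist_triangle _ y _).trans ((add_le_add hTd hd).trans_eq ?_)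
          rw [← ENNReal.ofReal_add (mul_nonneg hL (by linarith)) (by positivity), h1]
          congr 1; ring
  obtain ⟨n, hn⟩ := exists_nat_gt ((a - b) / δ)
  rw [div_lt_iff₀ hδ] at hn
  obtain ⟨T, hTc, hT⟩ := key n
  have h0 : ∀ x ∈ K, ∀ s ∈ Icc b a, |s - f (T x s)| = 0 := by
    intro x hx s hs
    refine le_antisymm ?_ (abs_nonneg _)
    refine (hT x hx s hs).2.1.trans (max_le le_rfl ?_)
    have h1 : |s - f x| ≤ a - b := abs_sub_le_iff.2 ⟨by linarith [hs.2, hx.1], by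
      linarith [hs.1, hx.2]⟩
    linarith
  refine ⟨T, hTc, fun x hx s hs => ?_, fun x hx s hs => ?_⟩
  · linarith [abs_eq_zero.1 (h0 x hx s hs)]
  · simpa [h0 x hx s hs] using (hT x hx s hs).2.2.2

/-! ### Reaching the level zero, and raising from arbitrarily low levels -/

/-- Extending a transport by the identity below the level `b` gives a map that lowers `f` to
`max s b` where it exceeds this value, and is continuous on all of `f ≤ a`. -/
theorem IsLevelTransport.exists_lowering {f : X → ℝ} (hf : Continuous f) {L b a : ℝ}
    (hba : b ≤ a) {T : X → ℝ → X} (hT : IsLevelTransport f L b a T) :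
    ∃ A : X → ℝ → X, ContinuousOn (uncurry A) ((f ⁻¹' Iic a) ×ˢ univ) ∧
      ∀ x ∈ f ⁻¹' Iic a, ∀ s, f (A x s) = min (f x) (max s b) ∧
        edist x (A x s) ≤ ENNReal.ofReal (L * (f x - f (A x s))) := by
  classical
  have hmem : ∀ x s, b ≤ f x → f x ≤ a → min (f x) (max s b) ∈ Icc b a := fun x s h h' =>
    ⟨le_min h (le_max_right _ _), min_le_of_left_le h'⟩
  refine ⟨fun x s => if b ≤ f x then T x (min (f x) (max s b)) else x, ?_, fun x hx s => ?_⟩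
  · have hU : (f ⁻¹' Iic a) ×ˢ (univ : Set ℝ) =
        (f ⁻¹' Icc b a) ×ˢ univ ∪ (f ⁻¹' Iic b) ×ˢ univ := by
      rw [← union_prod, ← preimage_union, union_comm, Iic_union_Icc_eq_Iic hba]
    rw [hU]
    refine ContinuousOn.union_of_isClosed ?_ ?_ ((isClosed_Icc.preimage hf).prod isClosed_univ)
      ((isClosed_Iic.preimage hf).prod isClosed_univ)
    · have h2 : ContinuousOn (fun z : X × ℝ => ((z.1, min (f z.1) (max z.2 b)) : X × ℝ))
          ((f ⁻¹' Icc b a) ×ˢ univ) := by fun_prop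
      refine (ContinuousOn.comp (g := uncurry T) hT.continuousOn h2
        fun z hz => ⟨hz.1, hmem _ _ hz.1.1 hz.1.2⟩).congr fun z hz => ?_
      simp [uncurry, (show b ≤ f z.1 from hz.1.1)]
    · refine continuous_fst.continuousOn.congr fun z hz => ?_
      rcases (show f z.1 ≤ b from hz.1).lt_or_eq with h | h
      · simp [uncurry, not_le.2 h]
      · have : T z.1 (f z.1) = z.1 := hT.apply_self ⟨h.ge, h.le.trans hba⟩
        rw [h] at this
        simp [uncurry, h, this]
  · by_cases h : b ≤ f x
    · have hx' : x ∈ f ⁻¹' Icc b a := ⟨h, hx⟩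
      have h1 := hT.apply_eq x hx' _ (hmem x s h hx)
      simp only [h, if_true, h1, true_and]
      refine (hT.edist_le x hx' _ (hmem x s h hx)).trans_eq ?_
      rw [abs_sub_comm, abs_of_nonneg (sub_nonneg.2 (min_le_left _ _))]
    · simp only [h, if_false, edist_self, zero_le, and_true]
      exact (min_eq_left ((not_le.1 h).le.trans (le_max_right _ _))).symm

/-- Transports between all positive levels assemble to a map lowering `f` to any nonnegative
level, zero included: it is the uniform limit of the maps that lower `f` to the levels
`max s (a / 2 ^ n)`. -/
theorem exists_lowering_to_zero {f : X → ℝ} (hf : Continuous f) (hf0 : ∀ x, 0 ≤ f x) {L a : ℝ}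
    (hL : 0 ≤ L) (ha : 0 < a) (hK : IsCompact (f ⁻¹' Icc 0 a))
    (hT : ∀ b, 0 < b → b ≤ a → ∃ T, IsLevelTransport f L b a T) :
    ∃ D : X → ℝ → X, ContinuousOn (uncurry D) ((f ⁻¹' Icc 0 a) ×ˢ univ) ∧
      ∀ x ∈ f ⁻¹' Icc 0 a, ∀ s, f (D x s) = min (f x) (max s 0) ∧
        edist x (D x s) ≤ ENNReal.ofReal (L * (f x - f (D x s))) := by
  have hKeq : f ⁻¹' Icc 0 a = f ⁻¹' Iic a := by
    ext x; simp [hf0 x]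
  rw [hKeq] at hK ⊢
  have hpos : ∀ n : ℕ, 0 < a / 2 ^ n := fun n => by positivity
  have hle : ∀ n : ℕ, a / 2 ^ n ≤ a := fun n => div_le_self ha.le (one_le_pow₀ one_le_two)
  have hA : ∀ n : ℕ, ∃ A : X → ℝ → X, ContinuousOn (uncurry A) ((f ⁻¹' Iic a) ×ˢ univ) ∧
      ∀ x ∈ f ⁻¹' Iic a, ∀ s, f (A x s) = min (f x) (max s (a / 2 ^ n)) ∧
        edist x (A x s) ≤ ENNReal.ofReal (L * (f x - f (A x s))) := fun n => by
    obtain ⟨T, h⟩ := hT _ (hpos n) (hle n)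
    exact h.exists_lowering hf (hle n)
  choose A hAc hA using hA
  let D : ℕ → X → ℝ → X := fun n => Nat.rec (fun x _ => x) (fun n D x s => A (n + 1) (D x s) s) n
  have hDs : ∀ n x s, D (n + 1) x s = A (n + 1) (D n x s) s := fun n x s => rfl
  have hD : ∀ n, ContinuousOn (uncurry (D n)) ((f ⁻¹' Iic a) ×ˢ univ) ∧
      ∀ x ∈ f ⁻¹' Iic a, ∀ s, f (D n x s) = min (f x) (max s (a / 2 ^ n)) ∧
        edist x (D n x s) ≤ ENNReal.ofReal (L * (f x - f (D n x s))) := by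
    intro n
    induction n with
    | zero =>
      refine ⟨continuous_fst.continuousOn, fun x hx s => ⟨?_, by simp [D]⟩⟩
      have : f x ≤ max s (a / 2 ^ 0) := by simpa using Or.inr (show f x ≤ a from hx)
      exact (min_eq_left this).symm
    | succ n ih =>
      obtain ⟨hc, hd⟩ := ih
      have hm : ∀ x ∈ f ⁻¹' Iic a, ∀ s, D n x s ∈ f ⁻¹' Iic a := fun x hx s => by
        rw [mem_preimage, (hd x hx s).1]; exact min_le_of_left_le (show f x ≤ a from hx)
      refine ⟨?_, fun x hx s => ?_⟩
      · exact ContinuousOn.comp (g := uncurry (A (n + 1))) (hAc (n + 1))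
          (hc.prodMk continuous_snd.continuousOn) fun z hz => ⟨hm _ hz.1 _, mem_univ _⟩
      · obtain ⟨h1, h2⟩ := hd x hx s
        obtain ⟨h3, h4⟩ := hA (n + 1) _ (hm x hx s) s
        rw [hDs]
        constructor
        · rw [h3, h1, min_assoc, min_eq_right (max_le_max le_rfl _)]
          exact div_le_div_of_nonneg_left ha.le (by positivity)
            (pow_le_pow_right₀ one_le_two n.le_succ)
        · refine (edist_triangle _ (D n x s) _).trans ((add_le_add h2 h4).trans_eq ?_)
          rw [← ENNReal.ofReal_add]
          · congr 1; ring
          · exact mul_nonneg hL (by rw [h1]; exact sub_nonneg.2 (min_le_left _ _))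
          · exact mul_nonneg hL (by rw [h3]; exact sub_nonneg.2 (min_le_left _ _))
  have hm : ∀ n, ∀ x ∈ f ⁻¹' Iic a, ∀ s, D n x s ∈ f ⁻¹' Iic a := fun n x hx s => by
    rw [mem_preimage, ((hD n).2 x hx s).1]; exact min_le_of_left_le (show f x ≤ a from hx)
  set C : ENNReal := ENNReal.ofReal (L * a) with hC
  have hgeo : ∀ x ∈ f ⁻¹' Iic a, ∀ s n, edist (D n x s) (D (n + 1) x s) ≤ C / 2 ^ n := by
    intro x hx s n
    have h1 := ((hD n).2 x hx s).1
    have h2 := ((hD (n + 1)).2 x hx s).1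
    refine ((hA (n + 1) _ (hm n x hx s) s).2).trans ?_
    rw [← hDs, h1, h2]
    have h3 : C / 2 ^ n = ENNReal.ofReal (L * (a / 2 ^ n)) := by
      rw [hC, ← mul_div_assoc, ENNReal.ofReal_div_of_pos (by positivity),
        ENNReal.ofReal_pow (by norm_num)]
      norm_num
    rw [h3]
    refine ENNReal.ofReal_le_ofReal (mul_le_mul_of_nonneg_left ?_ hL)
    have h5 := hpos n
    have h6 := hpos (n + 1)
    have hx0 := hf0 x
    have h7 : max s (a / 2 ^ n) ≤ max s (a / 2 ^ (n + 1)) + a / 2 ^ n :=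
      max_le (by linarith [le_max_left s (a / 2 ^ (n + 1))])
        (by linarith [le_max_right s (a / 2 ^ (n + 1))])
    rcases min_cases (f x) (max s (a / 2 ^ (n + 1))) with ⟨h, _⟩ | ⟨h, _⟩ <;> rw [h]
    · linarith [min_le_left (f x) (max s (a / 2 ^ n))]
    · linarith [min_le_right (f x) (max s (a / 2 ^ n))]
  have hlim : ∀ x s, ∃ y, x ∈ f ⁻¹' Iic a → y ∈ f ⁻¹' Iic a ∧
      Tendsto (fun n => D n x s) atTop (𝓝 y) := by
    intro x s
    by_cases hx : x ∈ f ⁻¹' Iic a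
    · obtain ⟨y, hy, hy'⟩ := cauchySeq_tendsto_of_isComplete hK.isComplete
        (fun n => hm n x hx s)
        (cauchySeq_of_edist_le_geometric_two C ENNReal.ofReal_ne_top (hgeo x hx s))
      exact ⟨y, fun _ => ⟨hy, hy'⟩⟩
    · exact ⟨x, fun h => absurd h hx⟩
  choose E hE using hlim
  refine ⟨E, ?_, fun x hx s => ?_⟩
  · have hu : TendstoUniformlyOn (fun n => uncurry (D n)) (uncurry E) atTop
        ((f ⁻¹' Iic a) ×ˢ univ) := by
      rw [EMetric.tendstoUniformlyOn_iff]
      intro ε hε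
      have h0 : Tendsto (fun n : ℕ => 2 * C / 2 ^ n) atTop (𝓝 0) := by
        have h1 : 2 * C ≠ ⊤ := ENNReal.mul_ne_top (by simp) ENNReal.ofReal_ne_top
        have h2 := ENNReal.Tendsto.const_mul (a := 2 * C)
          (ENNReal.tendsto_pow_atTop_nhds_zero_of_lt_one (r := 2⁻¹) (by simp)) (Or.inr h1)
        simpa [div_eq_mul_inv, ENNReal.inv_pow] using h2
      filter_upwards [h0.eventually_lt_const hε] with n hn z hz
      rw [edist_comm]
      exact (edist_le_of_edist_le_geometric_two_of_tendsto C (hgeo z.1 hz.1 z.2)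
        (hE z.1 z.2 hz.1).2 n).trans_lt hn
    exact hu.continuousOn (Eventually.of_forall fun n => (hD n).1).frequently
  · have hl := (hE x s hx).2
    have hfl : Tendsto (fun n => f (D n x s)) atTop (𝓝 (f (E x s))) := (hf.tendsto _).comp hl
    have h0 : Tendsto (fun n : ℕ => a / 2 ^ n) atTop (𝓝 0) := by
      have := (tendsto_pow_atTop_nhds_zero_of_lt_one (r := (2 : ℝ)⁻¹) (by norm_num)
        (by norm_num)).const_mul a
      simpa [div_eq_mul_inv] using this
    have h1 : Tendsto (fun n => f (D n x s)) atTop (𝓝 (min (f x) (max s 0))) := by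
      simp only [((hD _).2 x hx s).1]
      exact tendsto_const_nhds.min (tendsto_const_nhds.max h0)
    refine ⟨tendsto_nhds_unique hfl h1, ?_⟩
    refine le_of_tendsto_of_tendsto' (tendsto_const_nhds.edist hl)
      (ENNReal.continuous_ofReal.tendsto _ |>.comp ((tendsto_const_nhds.sub hfl).const_mul L))
      fun n => ((hD n).2 x hx s).2

/-- Transports between all positive levels assemble to a map raising `f` to any level `s ≤ a`. The
transports from different lowest levels are unrelated, so they are composed: a point below
`a / 2 ^ n` is first raised to this level, and then by the map already built above it. In this
way the maps extend each other. -/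
theorem exists_raising {f : X → ℝ} (hf : Continuous f) {L a : ℝ} (ha : 0 < a)
    (hT : ∀ b, 0 < b → b ≤ a → ∃ T, IsLevelTransport f L b a T) :
    ∃ U : X → ℝ → X, ContinuousOn (uncurry U) ((f ⁻¹' Ioc 0 a) ×ˢ Iic a) ∧
      ∀ x ∈ f ⁻¹' Ioc 0 a, ∀ s ≤ a, f (U x s) = max (f x) s ∧ (s ≤ f x → U x s = x) := by
  classical
  have hpos : ∀ n : ℕ, 0 < a / 2 ^ n := fun n => by positivity
  have hle : ∀ n : ℕ, a / 2 ^ n ≤ a := fun n => div_le_self ha.le (one_le_pow₀ one_le_two)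
  have hsucc : ∀ n : ℕ, a / 2 ^ (n + 1) ≤ a / 2 ^ n := fun n =>
    div_le_div_of_nonneg_left ha.le (by positivity) (pow_le_pow_right₀ one_le_two n.le_succ)
  choose T hT using fun n => hT _ (hpos n) (hle n)
  let V : ℕ → X → ℝ → X := fun n => Nat.rec (fun x _ => x) (fun n V x s =>
    if s ≤ a / 2 ^ n then T (n + 1) x (max (f x) s)
      else V (T (n + 1) x (max (f x) (a / 2 ^ n))) s) n
  have hVs : ∀ n x s, V (n + 1) x s = if s ≤ a / 2 ^ n then T (n + 1) x (max (f x) s)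
      else V n (T (n + 1) x (max (f x) (a / 2 ^ n))) s := fun n x s => rfl
  have hV : ∀ n, ContinuousOn (uncurry (V n)) ((f ⁻¹' Icc (a / 2 ^ n) a) ×ˢ Iic a) ∧
      ∀ x ∈ f ⁻¹' Icc (a / 2 ^ n) a, ∀ s ≤ a,
        f (V n x s) = max (f x) s ∧ (s ≤ f x → V n x s = x) := by
    intro n
    induction n with
    | zero =>
      refine ⟨continuous_fst.continuousOn, fun x hx s hs => ⟨?_, fun _ => rfl⟩⟩
      have h1 : s ≤ f x := hs.trans (by simpa using hx.1)
      exact (max_eq_left h1).symm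
    | succ n ih =>
      obtain ⟨hc, hv⟩ := ih
      have hm : ∀ x ∈ f ⁻¹' Icc (a / 2 ^ (n + 1)) a, ∀ s ≤ a,
          max (f x) s ∈ Icc (a / 2 ^ (n + 1)) a := fun x hx s hs =>
        ⟨le_max_of_le_left hx.1, max_le hx.2 hs⟩
      have hm' : ∀ x ∈ f ⁻¹' Icc (a / 2 ^ (n + 1)) a,
          T (n + 1) x (max (f x) (a / 2 ^ n)) ∈ f ⁻¹' Icc (a / 2 ^ n) a := fun x hx => by
        rw [mem_preimage, (hT (n + 1)).apply_eq x hx _ (hm x hx _ (hle n))]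
        exact ⟨le_max_right _ _, max_le hx.2 (hle n)⟩
      constructor
      · have hU : (f ⁻¹' Icc (a / 2 ^ (n + 1)) a) ×ˢ Iic a =
            (f ⁻¹' Icc (a / 2 ^ (n + 1)) a) ×ˢ Iic (a / 2 ^ n) ∪
            (f ⁻¹' Icc (a / 2 ^ (n + 1)) a) ×ˢ Icc (a / 2 ^ n) a := by
          rw [← prod_union, Iic_union_Icc_eq_Iic (hle n)]
        have hcl := isClosed_Icc.preimage hf (t := Icc (a / 2 ^ (n + 1)) a)
        rw [hU]
        refine ContinuousOn.union_of_isClosed ?_ ?_ (hcl.prod isClosed_Iic)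
          (hcl.prod isClosed_Icc)
        · have h2 : ContinuousOn (fun z : X × ℝ => ((z.1, max (f z.1) z.2) : X × ℝ))
              ((f ⁻¹' Icc (a / 2 ^ (n + 1)) a) ×ˢ Iic (a / 2 ^ n)) := by fun_prop
          refine (ContinuousOn.comp (g := uncurry (T (n + 1))) (hT (n + 1)).continuousOn h2
            fun z hz => ⟨hz.1, hm _ hz.1 _ (hz.2.trans (hle n))⟩).congr fun z hz => ?_
          simp only [uncurry, hVs, Function.comp]
          exact if_pos hz.2
        · have h2 : ContinuousOn (fun z : X × ℝ => ((z.1, max (f z.1) (a / 2 ^ n)) : X × ℝ))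
              ((f ⁻¹' Icc (a / 2 ^ (n + 1)) a) ×ˢ Icc (a / 2 ^ n) a) := by fun_prop
          have h3 := ContinuousOn.comp (g := uncurry (T (n + 1))) (hT (n + 1)).continuousOn h2
            fun z hz => ⟨hz.1, hm _ hz.1 _ (hle n)⟩
          refine (ContinuousOn.comp (g := uncurry (V n)) hc
            (h3.prodMk continuous_snd.continuousOn)
            fun z hz => ⟨hm' _ hz.1, hz.2.2⟩).congr fun z hz => ?_
          simp only [uncurry, hVs, Function.comp]
          split_ifs with h
          · have h4 : z.2 = a / 2 ^ n := le_antisymm h hz.2.1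
            rw [h4, ((hv _ (hm' _ hz.1) _ (hle n)).2 (hm' _ hz.1).1)]
          · rfl
      · intro x hx s hs
        rw [hVs]
        split_ifs with h
        · refine ⟨(hT (n + 1)).apply_eq x hx _ (hm x hx s hs), fun h' => ?_⟩
          rw [max_eq_left h', (hT (n + 1)).apply_self hx]
        · obtain ⟨h1, h2⟩ := hv _ (hm' x hx) s hs
          rw [h1, (hT (n + 1)).apply_eq x hx _ (hm x hx _ (hle n)), max_assoc,
            max_eq_right (not_le.1 h).le]
          refine ⟨rfl, fun h' => ?_⟩
          have h3 : max (f x) (a / 2 ^ n) = f x := max_eq_left ((not_le.1 h).le.trans h')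
          have h4 := (hT (n + 1)).apply_self hx
          rw [h3, h4] at h2 ⊢
          exact h2 h'
  have hstep : ∀ n, ∀ x ∈ f ⁻¹' Icc (a / 2 ^ n) a, ∀ s ≤ a, V (n + 1) x s = V n x s := by
    intro n x hx s hs
    have hx' : x ∈ f ⁻¹' Icc (a / 2 ^ (n + 1)) a := ⟨(hsucc n).trans hx.1, hx.2⟩
    have h4 := (hT (n + 1)).apply_self hx'
    rw [hVs]
    split_ifs with h
    · have h1 : s ≤ f x := h.trans hx.1
      rw [max_eq_left h1, h4, ((hV n).2 x hx s hs).2 h1]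
    · rw [max_eq_left hx.1, h4]
  have hanti : Antitone fun n : ℕ => a / 2 ^ n := antitone_nat_of_succ_le hsucc
  have hcons : ∀ m n, m ≤ n → ∀ x ∈ f ⁻¹' Icc (a / 2 ^ m) a, ∀ s ≤ a, V n x s = V m x s := by
    intro m n hmn x hx s hs
    induction n, hmn using Nat.le_induction with
    | base => rfl
    | succ n hmn ih => rw [hstep n x ⟨(hanti hmn).trans hx.1, hx.2⟩ s hs, ih]
  have hex : ∀ x, ∃ n : ℕ, 0 < f x → a / 2 ^ n < f x := by
    intro x
    by_cases hx : 0 < f x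
    · obtain ⟨n, hn⟩ := exists_pow_lt_of_lt_one (div_pos hx ha) (by norm_num : (2 : ℝ)⁻¹ < 1)
      refine ⟨n, fun _ => ?_⟩
      rw [lt_div_iff₀ ha, inv_pow] at hn
      rwa [div_eq_inv_mul]
    · exact ⟨0, fun h => absurd h hx⟩
  choose N hN using hex
  refine ⟨fun x s => V (N x) x s, ?_, fun x hx s hs =>
    (hV (N x)).2 x ⟨(hN x hx.1).le, hx.2⟩ s hs⟩
  rintro ⟨x, s⟩ ⟨hx, hs⟩
  have hxN := hN x hx.1
  have h1 := (hV (N x)).1 (x, s) ⟨⟨hxN.le, hx.2⟩, hs⟩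
  have h2 : ContinuousWithinAt (uncurry (V (N x))) ((f ⁻¹' Ioc 0 a) ×ˢ Iic a) (x, s) := by
    refine h1.mono_of_mem_nhdsWithin ?_
    have : Prod.fst ⁻¹' (f ⁻¹' Ioi (a / 2 ^ N x)) ∈ 𝓝[(f ⁻¹' Ioc 0 a) ×ˢ Iic a] (x, s) :=
      mem_nhdsWithin_of_mem_nhds
        (((isOpen_Ioi.preimage hf).preimage continuous_fst).mem_nhds hxN)
    filter_upwards [this, self_mem_nhdsWithin] with z hz hz'
    exact ⟨⟨(show _ < _ from hz).le, hz'.1.2⟩, hz'.2⟩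
  refine h2.congr_of_eventuallyEq ?_ rfl
  have : Prod.fst ⁻¹' (f ⁻¹' Ioi (a / 2 ^ N x)) ∈ 𝓝[(f ⁻¹' Ioc 0 a) ×ˢ Iic a] (x, s) :=
    mem_nhdsWithin_of_mem_nhds (((isOpen_Ioi.preimage hf).preimage continuous_fst).mem_nhds hxN)
  filter_upwards [this, self_mem_nhdsWithin] with z hz hz'
  have hzN := hN z.1 hz'.1.1
  have e1 : V (N z.1) z.1 z.2 = V (max (N z.1) (N x)) z.1 z.2 :=
    (hcons _ _ (le_max_left _ _) z.1 ⟨hzN.le, hz'.1.2⟩ z.2 hz'.2).symm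
  have e2 : V (N x) z.1 z.2 = V (max (N z.1) (N x)) z.1 z.2 :=
    (hcons _ _ (le_max_right _ _) z.1 ⟨(show _ < _ from hz).le, hz'.1.2⟩ z.2 hz'.2).symm
  exact e1.trans e2.symm

/-! ### The deformation retractions -/

/-- A set `A ⊆ Y` is a strong deformation retract of `Y` as soon as there is a homotopy `H`, given
as a map on the ambient space that is continuous on `Y`. -/
theorem IsStrongDeformationRetract.of_continuousOn {X : Type*} [TopologicalSpace X] {A Y : Set X}
    (hAY : A ⊆ Y) (H : ℝ → X → X) (hH : ContinuousOn (uncurry H) (Icc 0 1 ×ˢ Y))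
    (hmaps : ∀ t ∈ Icc (0 : ℝ) 1, ∀ y ∈ Y, H t y ∈ Y) (h0 : ∀ y ∈ Y, H 0 y = y)
    (h1 : ∀ y ∈ Y, H 1 y ∈ A) (hA : ∀ t ∈ Icc (0 : ℝ) 1, ∀ y ∈ A, H t y = y) :
    IsStrongDeformationRetract A Y := by
  let G : unitInterval × Y → Y := fun z => ⟨H z.1 z.2, hmaps _ z.1.2 _ z.2.2⟩
  have hG : Continuous G := by
    refine Continuous.subtype_mk ?_ _
    exact hH.comp_continuous
      ((continuous_subtype_val.comp continuous_fst).prodMk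
        (continuous_subtype_val.comp continuous_snd)) fun z => ⟨z.1.2, z.2.2⟩
  refine ⟨hAY, ⟨fun y => G (1, y), hG.comp (by fun_prop)⟩, fun y => h1 y y.2, ⟨?_⟩⟩
  exact
    { toFun := G
      continuous_toFun := hG
      map_zero_left := fun y => Subtype.ext (h0 y y.2)
      map_one_left := fun y => rfl
      prop' := fun t y hy => Subtype.ext (hA t t.2 y hy) }

/-- If points can locally be moved so as to change `f` by `τ` at the cost of a distance at most
`L * |τ|`, with a constant `L` independent of the place, then the zero set and the superlevel set
are strong deformation retracts. -/
theorem isStrongDeformationRetract_of_forall_isLevelPush {f : X → ℝ} (hf : Continuous f)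
    (hf0 : ∀ x, 0 ≤ f x) {L a : ℝ} (hL : 0 ≤ L) (ha : 0 < a) (hK : IsCompact (f ⁻¹' Icc 0 a))
    (hloc : ∀ p, 0 < f p →
      ∃ r > 0, ∃ P, IsLevelPush f L (Metric.eball p (ENNReal.ofReal r)) r P) :
    IsStrongDeformationRetract (f ⁻¹' {0}) (f ⁻¹' Icc 0 a) ∧
      IsStrongDeformationRetract (f ⁻¹' Ici a) (f ⁻¹' {0})ᶜ := by
  classical
  have hT : ∀ b, 0 < b → b ≤ a → ∃ T, IsLevelTransport f L b a T := by
    intro b hb _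
    have hKb : IsCompact (f ⁻¹' Icc b a) := hK.of_isClosed_subset (isClosed_Icc.preimage hf)
      (preimage_mono (Icc_subset_Icc_left hb.le))
    obtain ⟨δ, hδ, P, hP⟩ := exists_isLevelPush_of_isCompact hL hKb
      fun p hp => hloc p (hb.trans_le hp.1)
    exact hP.exists_isLevelTransport hf hL hδ
  constructor
  · obtain ⟨D, hDc, hD⟩ := exists_lowering_to_zero hf hf0 hL ha hK hT
    have hsub : f ⁻¹' {0} ⊆ f ⁻¹' Icc 0 a := preimage_mono (by simp [ha.le])
    have hfix : ∀ y ∈ f ⁻¹' Icc 0 a, ∀ s, f (D y s) = f y → D y s = y := by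
      intro y hy s h
      have := (hD y hy s).2
      rw [h, sub_self, mul_zero, ENNReal.ofReal_zero, nonpos_iff_eq_zero, edist_eq_zero] at this
      exact this.symm
    -- the target level decreases from `a`, where nothing moves, to `0`
    refine .of_continuousOn hsub (fun t y => D y ((1 - t) * a)) ?_ ?_ ?_ ?_ ?_
    · exact ContinuousOn.comp (g := uncurry D) hDc (f := fun z : ℝ × X => (z.2, (1 - z.1) * a))
        (by fun_prop) fun z hz => ⟨hz.2, mem_univ _⟩
    · intro t _ y hy
      refine ⟨hf0 _, ?_⟩
      rw [(hD y hy _).1]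
      exact min_le_of_left_le hy.2
    · intro y hy
      refine hfix y hy _ ?_
      rw [(hD y hy _).1]
      exact min_eq_left (le_max_of_le_left (by simpa using hy.2))
    · intro y hy
      rw [mem_preimage, (hD y hy _).1]
      simpa using hf0 y
    · intro t _ y hy
      have hy0 : f y = 0 := hy
      refine hfix y (hsub hy) _ ?_
      rw [(hD y (hsub hy) _).1, hy0]
      exact min_eq_left (le_max_right _ _)
  · obtain ⟨U, hUc, hU⟩ := exists_raising hf ha hT
    have hpos : ∀ y, y ∈ (f ⁻¹' {0})ᶜ → 0 < f y := fun y hy => lt_of_le_of_ne (hf0 y) (Ne.symm hy)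
    have hta : ∀ t ∈ Icc (0 : ℝ) 1, t * a ≤ a := fun t ht => mul_le_of_le_one_left ha.le ht.2
    -- the target level increases from `0`, where nothing moves, to `a`
    refine .of_continuousOn (fun y hy h => ?_)
      (fun t y => if f y ≤ a then U y (t * a) else y) ?_ ?_ ?_ ?_ ?_
    · have h1 : a ≤ f y := hy
      rw [(show f y = 0 from h)] at h1
      linarith
    · have hS : Icc (0 : ℝ) 1 ×ˢ (f ⁻¹' {0})ᶜ =
          (Icc (0 : ℝ) 1 ×ˢ (f ⁻¹' {0})ᶜ) ∩ Prod.snd ⁻¹' (f ⁻¹' Iic a) ∪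
          (Icc (0 : ℝ) 1 ×ˢ (f ⁻¹' {0})ᶜ) ∩ Prod.snd ⁻¹' (f ⁻¹' Ici a) := by
        rw [← inter_union_distrib_left, ← preimage_union, ← preimage_union, Iic_union_Ici]
        simp
      have hc1 : IsClosed (Prod.snd ⁻¹' (f ⁻¹' Iic a) : Set (ℝ × X)) :=
        (isClosed_Iic.preimage hf).preimage continuous_snd
      have hc2 : IsClosed (Prod.snd ⁻¹' (f ⁻¹' Ici a) : Set (ℝ × X)) :=
        (isClosed_Ici.preimage hf).preimage continuous_snd
      have k1 : ContinuousOn (uncurry fun t y => if f y ≤ a then U y (t * a) else y)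
          ((Icc (0 : ℝ) 1 ×ˢ (f ⁻¹' {0})ᶜ) ∩ Prod.snd ⁻¹' (f ⁻¹' Iic a)) := by
        refine (ContinuousOn.comp (g := uncurry U) hUc (f := fun z : ℝ × X => (z.2, z.1 * a))
          (by fun_prop) fun z hz => ⟨⟨hpos _ hz.1.2, hz.2⟩, hta _ hz.1.1⟩).congr fun z hz => ?_
        exact if_pos hz.2
      have k2 : ContinuousOn (uncurry fun t y => if f y ≤ a then U y (t * a) else y)
          ((Icc (0 : ℝ) 1 ×ˢ (f ⁻¹' {0})ᶜ) ∩ Prod.snd ⁻¹' (f ⁻¹' Ici a)) := by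
        refine continuous_snd.continuousOn.congr fun z hz => ?_
        simp only [uncurry]
        split_ifs with h
        · exact (hU z.2 ⟨hpos _ hz.1.2, h⟩ _ (hta _ hz.1.1)).2 ((hta _ hz.1.1).trans hz.2)
        · rfl
      rw [hS]
      intro z hz
      refine continuousWithinAt_union.2 ⟨?_, ?_⟩
      · by_cases h : z ∈ Prod.snd ⁻¹' (f ⁻¹' Iic a)
        · exact k1 z ⟨by rw [hS]; exact hz, h⟩
        · exact continuousWithinAt_of_notMem_closure fun h' =>
            h (closure_minimal inter_subset_right hc1 h')
      · by_cases h : z ∈ Prod.snd ⁻¹' (f ⁻¹' Ici a)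
        · exact k2 z ⟨by rw [hS]; exact hz, h⟩
        · exact continuousWithinAt_of_notMem_closure fun h' =>
            h (closure_minimal inter_subset_right hc2 h')
    · intro t ht y hy
      have hy0 := hpos y hy
      by_cases h : f y ≤ a
      · simp only [h, if_true]
        have h1 := (hU y ⟨hy0, h⟩ _ (hta t ht)).1
        have h2 : 0 < f (U y (t * a)) := h1 ▸ lt_max_of_lt_left hy0
        exact h2.ne'
      · simpa only [h, if_false] using hy
    · intro y hy
      have hy0 := hpos y hy
      by_cases h : f y ≤ a
      · simp only [h, if_true]
        exact (hU y ⟨hy0, h⟩ _ (by simpa using ha.le)).2 (by simpa using hy0.le)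
      · simp [h]
    · intro y hy
      have hy0 := hpos y hy
      by_cases h : f y ≤ a
      · simp only [h, if_true]
        rw [mem_preimage, (hU y ⟨hy0, h⟩ _ (by simp)).1]
        simp
      · simp only [h, if_false]
        exact (not_le.1 h).le
    · intro t ht y hy
      have hy' : a ≤ f y := hy
      split_ifs with h
      · exact (hU y ⟨ha.trans_le hy', h⟩ _ (hta t ht)).2 ((hta t ht).trans hy')
      · rfl

end EMetric

/-! ### Straightening a function along a vector -/

/-- Moving a point so that a function `F` with `F' v = 1` changes by a prescribed amount: the map
`G y = y + (F y - F' y) • v` has derivative the identity and satisfies `F' ∘ G = F`, so that in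
the coordinates given by `G` one just moves along `v`. -/
theorem HasStrictFDerivAt.exists_push {E : Type*} [NormedAddCommGroup E] [NormedSpace ℝ E]
    [CompleteSpace E] {F : E → ℝ} {F' : E →L[ℝ] ℝ} {y₀ : E} (hF : HasStrictFDerivAt F F' y₀)
    (hFc : ∀ᶠ y in 𝓝 y₀, ContinuousAt F y) {v : E} (hv : F' v = 1) :
    ∃ Q : E × ℝ → E, (∀ᶠ z in 𝓝 (y₀, (0 : ℝ)), ContinuousAt Q z) ∧
      (∀ᶠ z in 𝓝 (y₀, (0 : ℝ)), F (Q z) = F z.1 + z.2) ∧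
      ∀ ε > 0, ∀ᶠ z in 𝓝 (y₀, (0 : ℝ)), ‖Q z - z.1 - z.2 • v‖ ≤ ε * |z.2| := by
  set G : E → E := fun y => y + (F y - F' y) • v with hG
  have hFG : ∀ y, F' (G y) = F y := fun y => by simp [hG, hv]
  have hGd : HasStrictFDerivAt G ((ContinuousLinearEquiv.refl ℝ E : E ≃L[ℝ] E) : E →L[ℝ] E) y₀ := by
    have h := (hasStrictFDerivAt_id (𝕜 := ℝ) y₀).add ((hF.sub F'.hasStrictFDerivAt).smul_const v)
    convert! h using 1
    ext; simp
  set e := hGd.toOpenPartialHomeomorph G with he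
  have hcoe : ∀ y, e y = G y := fun y => rfl
  have hGc : ∀ᶠ y in 𝓝 y₀, ContinuousAt G y := by
    filter_upwards [hFc] with y hy
    exact continuousAt_id.add ((hy.sub F'.continuous.continuousAt).smul continuousAt_const)
  have hfst : Tendsto (Prod.fst : E × ℝ → E) (𝓝 (y₀, (0 : ℝ))) (𝓝 y₀) := continuous_fst.tendsto _
  have hG1 : Tendsto (fun z : E × ℝ => G z.1) (𝓝 (y₀, (0 : ℝ))) (𝓝 (G y₀)) :=
    hGc.self_of_nhds.tendsto.comp hfst
  have hmove : Tendsto (fun z : E × ℝ => G z.1 + z.2 • v) (𝓝 (y₀, (0 : ℝ))) (𝓝 (G y₀)) := by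
    have h2 : Tendsto (fun z : E × ℝ => z.2 • v) (𝓝 (y₀, (0 : ℝ))) (𝓝 ((0 : ℝ) • v)) :=
      (continuous_snd.tendsto (y₀, (0 : ℝ))).smul_const v
    simpa using hG1.add h2
  have hsrc : ∀ᶠ z : E × ℝ in 𝓝 (y₀, (0 : ℝ)), z.1 ∈ e.source :=
    hfst.eventually (e.open_source.mem_nhds hGd.mem_toOpenPartialHomeomorph_source)
  have htgt : ∀ᶠ z : E × ℝ in 𝓝 (y₀, (0 : ℝ)), G z.1 + z.2 • v ∈ e.target :=
    hmove.eventually (e.open_target.mem_nhds hGd.image_mem_toOpenPartialHomeomorph_target)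
  refine ⟨fun z => e.symm (G z.1 + z.2 • v), ?_, ?_, fun ε hε => ?_⟩
  · filter_upwards [htgt, hfst.eventually hGc] with z hz hzc
    refine ContinuousAt.comp (g := e.symm) (f := fun z : E × ℝ => G z.1 + z.2 • v)
      (e.continuousAt_symm hz) ?_
    exact (ContinuousAt.comp (f := Prod.fst) (x := z) hzc continuousAt_fst).add
      (continuousAt_snd.smul continuousAt_const)
  · filter_upwards [htgt] with z hz
    rw [← hFG (e.symm _), ← hcoe (e.symm _), e.right_inv hz]
    simp [hFG, hv]
  · have hd := hGd.to_localInverse.isLittleO.def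
      (show 0 < ε / (‖v‖ + 1) by positivity)
    filter_upwards [(hmove.prodMk_nhds hG1).eventually hd, hsrc] with z hz hzs
    have h1 : hGd.localInverse G _ y₀ (G z.1) = z.1 := e.left_inv hzs
    have h2 : hGd.localInverse G _ y₀ (G z.1 + z.2 • v) = e.symm (G z.1 + z.2 • v) := rfl
    simp only [h1, h2, ContinuousLinearEquiv.refl_symm, ContinuousLinearEquiv.coe_refl,
      ContinuousLinearMap.coe_id', id, add_sub_cancel_left, norm_smul, Real.norm_eq_abs] at hz
    refine hz.trans ?_
    rw [div_mul_eq_mul_div, div_le_iff₀ (by positivity)]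
    have h3 := abs_nonneg z.2
    have h4 := mul_nonneg hε.le h3
    nlinarith

/-! ### Local moves on a Riemannian manifold -/

section Manifold

variable {E : Type*} [NormedAddCommGroup E] [NormedSpace ℝ E]
  {M : Type*} [EMetricSpace M] [ChartedSpace E M] [IsManifold 𝓘(ℝ, E) 1 M]
  [Bundle.RiemannianBundle (fun x : M => TangentSpace 𝓘(ℝ, E) x)]

/-- The Riemannian norm of a tangent vector read in a chart is upper semicontinuous in the point
and the vector. -/
theorem eventually_norm_mfderiv_extChartAt_symm_lt
    [IsContinuousRiemannianBundle E (fun x : M => TangentSpace 𝓘(ℝ, E) x)]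
    (p : M) (v : TangentSpace 𝓘(ℝ, E) p) {C : ℝ} (hC : ‖v‖ < C) :
    ∀ᶠ z : E × E in 𝓝 (extChartAt 𝓘(ℝ, E) p p, v),
      ‖mfderiv 𝓘(ℝ, E) 𝓘(ℝ, E) (extChartAt 𝓘(ℝ, E) p).symm z.1 z.2‖ < C := by
  set φ := extChartAt 𝓘(ℝ, E) p with hφ
  have hto : IsOpen φ.target := isOpen_extChartAt_target p
  have hsm : ContMDiffOn 𝓘(ℝ, E) 𝓘(ℝ, E) 1 φ.symm φ.target := contMDiffOn_extChartAt_symm p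
  have h1 := hsm.continuousOn_tangentMapWithin le_rfl hto.uniqueMDiffOn
  have h2 : ContinuousAt (fun z : E × E => (⟨φ.symm z.1, mfderivWithin 𝓘(ℝ, E) 𝓘(ℝ, E) φ.symm
      φ.target z.1 z.2⟩ : TangentBundle 𝓘(ℝ, E) M)) (φ p, v) := by
    have h3 := (tangentBundleModelSpaceHomeomorph 𝓘(ℝ, E)).symm.continuous
    have h4 : (φ p, v) ∈ (fun z : E × E => ((tangentBundleModelSpaceHomeomorph 𝓘(ℝ, E)).symm
        (z.1, z.2))) ⁻¹' (Bundle.TotalSpace.proj ⁻¹' φ.target) := mem_extChartAt_target p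
    have h5 := (h1.comp (h3.continuousOn) (mapsTo_preimage _ _))
    have hproj := FiberBundle.continuous_proj E (TangentSpace 𝓘(ℝ, E) (M := E))
    exact h5.continuousAt (((hto.preimage hproj).preimage h3).mem_nhds h4)
  have h6 : ContinuousAt (fun z : E × E => inner ℝ
      (mfderivWithin 𝓘(ℝ, E) 𝓘(ℝ, E) φ.symm φ.target z.1 z.2)
      (mfderivWithin 𝓘(ℝ, E) 𝓘(ℝ, E) φ.symm φ.target z.1 z.2)) (φ p, v) := h2.inner_bundle h2
  -- at the centre `p` of its own chart, the derivative of the chart is the identity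
  have h7 : mfderivWithin 𝓘(ℝ, E) 𝓘(ℝ, E) φ.symm φ.target (φ p) =
      ContinuousLinearMap.id ℝ _ := by
    have h := mfderivWithin_range_extChartAt_symm (I := 𝓘(ℝ, E)) (x := p)
    rw [modelWithCornersSelf_coe, range_id, mfderivWithin_univ] at h
    rw [mfderivWithin_of_isOpen hto (mem_extChartAt_target p)]
    exact h
  have h8 : ContinuousAt (fun z : E × E =>
      ‖mfderivWithin 𝓘(ℝ, E) 𝓘(ℝ, E) φ.symm φ.target z.1 z.2‖) (φ p, v) := by
    simp only [norm_eq_sqrt_real_inner]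
    exact Real.continuous_sqrt.continuousAt.comp h6
  have h9 : ‖mfderivWithin 𝓘(ℝ, E) 𝓘(ℝ, E) φ.symm φ.target (φ p) v‖ < C := by
    -- generalizing the base point lets `φ.symm (φ p)` be replaced by `p` in the type
    have key : ∀ (q : M) (L : E →L[ℝ] E), q = p → L = ContinuousLinearMap.id ℝ E →
        ‖(show TangentSpace 𝓘(ℝ, E) q from L v)‖ < C := by
      rintro q L rfl rfl
      exact hC
    exact key _ _ (extChartAt_to_inv p) h7
  have h10 : ∀ᶠ z : E × E in 𝓝 (φ p, v), z.1 ∈ φ.target :=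
    (continuous_fst.tendsto (φ p, (v : E))).eventually (hto.mem_nhds (mem_extChartAt_target p))
  filter_upwards [h8.eventually_lt_const h9, h10] with z hz hz'
  rwa [mfderivWithin_of_isOpen hto hz'] at hz

/-- The distance of two points is at most the length of the curve that is a segment in a chart. -/
theorem edist_extChartAt_symm_le [IsRiemannianManifold 𝓘(ℝ, E) M] (p : M) {y y' : E} {C : ENNReal}
    (h : ∀ z ∈ segment ℝ y y', z ∈ (extChartAt 𝓘(ℝ, E) p).target ∧
      ‖mfderiv 𝓘(ℝ, E) 𝓘(ℝ, E) (extChartAt 𝓘(ℝ, E) p).symm z (y' - y)‖ₑ ≤ C) :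
    edist ((extChartAt 𝓘(ℝ, E) p).symm y) ((extChartAt 𝓘(ℝ, E) p).symm y') ≤ C := by
  set φ := extChartAt 𝓘(ℝ, E) p with hφ
  let η : ℝ →ᴬ[ℝ] E := ContinuousAffineMap.lineMap y y'
  have hη : ∀ t ∈ Icc (0 : ℝ) 1, η t ∈ segment ℝ y y' := by
    intro t ht
    rw [segment_eq_image_lineMap]
    exact ⟨t, ht, rfl⟩
  have hηd : ContDiff ℝ 1 η := ContinuousAffineMap.contDiff _
  have hηv : ∀ t, HasFDerivAt η (ContinuousLinearMap.toSpanSingleton ℝ (y' - y)) t := by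
    intro t
    exact (AffineMap.hasDerivAt_lineMap (a := y) (b := y') (x := t)).hasFDerivAt
  rw [IsRiemannianManifold.out (I := 𝓘(ℝ, E))]
  have h1 : Manifold.riemannianEDist 𝓘(ℝ, E) (φ.symm y) (φ.symm y') ≤
      Manifold.pathELength 𝓘(ℝ, E) (φ.symm ∘ η) 0 1 := by
    apply Manifold.riemannianEDist_le_pathELength _ _ _ zero_le_one
    · exact (contMDiffOn_extChartAt_symm p).comp (contMDiff_iff_contDiff.2 hηd).contMDiffOn
        fun t ht => (h _ (hη t ht)).1
    · simp [η, ContinuousAffineMap.coe_lineMap_eq]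
    · simp [η, ContinuousAffineMap.coe_lineMap_eq]
  refine h1.trans ?_
  rw [Manifold.pathELength_eq_lintegral_mfderiv_Icc]
  have h2 : ∀ t ∈ Icc (0 : ℝ) 1, ‖mfderiv 𝓘(ℝ, ℝ) 𝓘(ℝ, E) (φ.symm ∘ η) t 1‖ₑ ≤ C := by
    intro t ht
    obtain ⟨hz, hzC⟩ := h _ (hη t ht)
    have h3 : MDifferentiableAt 𝓘(ℝ, E) 𝓘(ℝ, E) φ.symm (η t) := by
      have := mdifferentiableWithinAt_extChartAt_symm (I := 𝓘(ℝ, E)) hz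
      rwa [modelWithCornersSelf_coe, range_id, mdifferentiableWithinAt_univ] at this
    have h4 := h3.hasMFDerivAt.comp t (hηv t).hasMFDerivAt
    rw [h4.mfderiv]
    have h5 : (ContinuousLinearMap.toSpanSingleton ℝ (y' - y)) (1 : ℝ) = y' - y := by simp
    rw [← h5] at hzC
    exact hzC
  refine (MeasureTheory.setLIntegral_mono' measurableSet_Icc h2).trans ?_
  simp

/-- Where the gradient of a `C¹` function is longer than `α`, points can be moved so as to change
the function by `τ` at the cost of a distance at most `|τ| / α`: move them, in coordinates
straightening the function, along `∇ f / ‖∇ f‖ ^ 2`, whose length is less than `1 / α`. -/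
theorem exists_isLevelPush_of_lt_norm_riemannianGradient [FiniteDimensional ℝ E]
    [IsContinuousRiemannianBundle E (fun x : M => TangentSpace 𝓘(ℝ, E) x)]
    [IsRiemannianManifold 𝓘(ℝ, E) M] {f : M → ℝ} {p : M}
    (hf : ContMDiffAt 𝓘(ℝ, E) 𝓘(ℝ, ℝ) 1 f p) {α : ℝ} (hα : 0 < α)
    (hgrad : α < ‖(riemannianGradient f p : TangentSpace 𝓘(ℝ, E) p)‖) :
    ∃ r > 0, ∃ P, IsLevelPush f α⁻¹ (Metric.eball p (ENNReal.ofReal r)) r P := by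
  have : CompleteSpace E := FiniteDimensional.complete ℝ E
  set φ := extChartAt 𝓘(ℝ, E) p with hφ
  set F : E → ℝ := f ∘ φ.symm with hFdef
  have hFd : ContDiffAt ℝ 1 F (φ p) := by
    have h := (contMDiffAt_iff.1 hf).2
    rw [modelWithCornersSelf_coe, range_id, contDiffWithinAt_univ] at h
    exact h
  have hF : HasStrictFDerivAt F (fderiv ℝ F (φ p)) (φ p) := hFd.hasStrictFDerivAt one_ne_zero
  have hFc : ∀ᶠ y in 𝓝 (φ p), ContinuousAt F y :=
    (hFd.eventually (by simp)).mono fun y hy => hy.continuousAt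
  set g : TangentSpace 𝓘(ℝ, E) p := riemannianGradient f p with hg
  have hg0 : 0 < ‖g‖ := hα.trans hgrad
  set u : TangentSpace 𝓘(ℝ, E) p := (‖g‖ ^ 2)⁻¹ • g with hu
  have hun : ‖u‖ < α⁻¹ := by
    have h : ‖u‖ = ‖g‖⁻¹ := by
      rw [hu, norm_smul, norm_inv, norm_pow, norm_norm]
      field_simp
    rw [h]
    exact inv_strictAnti₀ hα hgrad
  have hFu : fderiv ℝ F (φ p) u = 1 := by
    have h1 : mvfderiv 𝓘(ℝ, E) f p u = 1 := by
      rw [← inner_riemannianGradient, ← hg, hu, inner_smul_right, real_inner_self_eq_norm_sq]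
      exact inv_mul_cancel₀ (by positivity)
    have h2 : mfderiv 𝓘(ℝ, E) 𝓘(ℝ, ℝ) f p = fderiv ℝ F (φ p) := by
      rw [(hf.mdifferentiableAt one_ne_zero).mfderiv, modelWithCornersSelf_coe, range_id,
        fderivWithin_univ]
      rfl
    rw [← h1, ← h2]
    rfl
  obtain ⟨v, hFv, hev⟩ : ∃ v : E, fderiv ℝ F (φ p) v = 1 ∧ ∀ᶠ z : E × E in 𝓝 (φ p, v),
      ‖mfderiv 𝓘(ℝ, E) 𝓘(ℝ, E) φ.symm z.1 z.2‖ < α⁻¹ :=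
    ⟨u, hFu, eventually_norm_mfderiv_extChartAt_symm_lt p u hun⟩
  obtain ⟨Q, hQc, hQF, hQε⟩ := hF.exists_push hFc hFv
  have hto : IsOpen φ.target := isOpen_extChartAt_target p
  -- a product neighbourhood on which vectors close to `v` are shorter than `α⁻¹`
  obtain ⟨ε, hε, hball⟩ : ∃ ε > 0, ∀ y ∈ Metric.ball (φ p) ε, y ∈ φ.target ∧
      ∀ w ∈ Metric.ball v ε, ‖mfderiv 𝓘(ℝ, E) 𝓘(ℝ, E) φ.symm y w‖ < α⁻¹ := by
    obtain ⟨ε₁, hε₁, h₁⟩ := Metric.eventually_nhds_iff_ball.1 hev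
    obtain ⟨ε₂, hε₂, h₂⟩ := Metric.mem_nhds_iff.1 (hto.mem_nhds (mem_extChartAt_target p))
    refine ⟨min ε₁ ε₂, lt_min hε₁ hε₂, fun y hy => ⟨h₂ ?_, fun w hw => h₁ (y, w) ?_⟩⟩
    · exact Metric.ball_subset_ball (min_le_right _ _) hy
    · rw [← ball_prod_same]
      exact ⟨Metric.ball_subset_ball (min_le_left _ _) hy,
        Metric.ball_subset_ball (min_le_left _ _) hw⟩
  have hQ0 : Q (φ p, 0) = φ p := by
    have := (hQε 1 one_pos).self_of_nhds
    simpa [sub_eq_zero] using this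
  have hnear : ∀ᶠ z in 𝓝 (φ p, (0 : ℝ)), Q z ∈ Metric.ball (φ p) ε := by
    have := hQc.self_of_nhds.tendsto
    rw [hQ0] at this
    exact this.eventually (Metric.ball_mem_nhds _ hε)
  have hnear' : ∀ᶠ z : E × ℝ in 𝓝 (φ p, (0 : ℝ)), z.1 ∈ Metric.ball (φ p) ε :=
    (continuous_fst.tendsto (φ p, (0 : ℝ))).eventually (Metric.ball_mem_nhds _ hε)
  have hφc : Tendsto (fun z : M × ℝ => (φ z.1, z.2)) (𝓝 (p, 0)) (𝓝 (φ p, 0)) :=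
    ((continuousAt_extChartAt p).tendsto.comp (continuous_fst.tendsto (p, (0 : ℝ)))).prodMk_nhds
      (continuous_snd.tendsto (p, (0 : ℝ)))
  have hsrc : ∀ᶠ z : M × ℝ in 𝓝 (p, 0), z.1 ∈ φ.source :=
    (continuous_fst.tendsto (p, (0 : ℝ))).eventually (extChartAt_source_mem_nhds p)
  have hall := hsrc.and (hφc.eventually
    (hQc.and (hQF.and ((hQε (ε / 2) (half_pos hε)).and (hnear.and hnear')))))
  obtain ⟨r, hr, hgood⟩ : ∃ r > 0, ∀ q ∈ Metric.eball p (ENNReal.ofReal r), ∀ τ ∈ Icc (-r) r,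
      (q, τ) ∈ {z : M × ℝ | z.1 ∈ φ.source ∧ ContinuousAt Q (φ z.1, z.2) ∧
        F (Q (φ z.1, z.2)) = F (φ z.1) + z.2 ∧
        ‖Q (φ z.1, z.2) - φ z.1 - z.2 • v‖ ≤ ε / 2 * |z.2| ∧
        Q (φ z.1, z.2) ∈ Metric.ball (φ p) ε ∧ φ z.1 ∈ Metric.ball (φ p) ε} := by
    obtain ⟨A, hA, B, hB, hAB⟩ := mem_nhds_prod_iff.1 hall
    obtain ⟨e, he, heA⟩ := EMetric.mem_nhds_iff.1 hA
    obtain ⟨d, hd, hdB⟩ := Metric.mem_nhds_iff.1 hB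
    have he1 : min e 1 ≠ ⊤ := ((min_le_right e 1).trans_lt ENNReal.one_lt_top).ne
    have he0 : 0 < (min e 1).toReal := ENNReal.toReal_pos (lt_min he one_pos).ne' he1
    refine ⟨min (min e 1).toReal (d / 2), lt_min he0 (half_pos hd), fun q hq τ hτ =>
      hAB ⟨heA ?_, hdB ?_⟩⟩
    · refine Metric.eball_subset_eball ?_ hq
      refine (ENNReal.ofReal_le_ofReal (min_le_left _ _)).trans ?_
      rw [ENNReal.ofReal_toReal he1]
      exact min_le_left _ _
    · rw [mem_ball_zero_iff, Real.norm_eq_abs]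
      have := (abs_le.2 hτ).trans (min_le_right _ _)
      linarith
  refine ⟨r, hr, fun q τ => φ.symm (Q (φ q, τ)), ?_, fun q hq τ hτ => ?_, fun q hq τ hτ => ?_⟩
  · rintro ⟨q, τ⟩ ⟨hq, hτ⟩
    obtain ⟨hqs, hc, -, -, hb, -⟩ := hgood q hq τ hτ
    refine ContinuousAt.continuousWithinAt ?_
    have h1 : ContinuousAt (fun z : M × ℝ => (φ z.1, z.2)) (q, τ) :=
      (ContinuousAt.comp (f := Prod.fst) (x := (q, τ)) (continuousAt_extChartAt' hqs)
        continuousAt_fst).prodMk continuousAt_snd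
    have h2 : ContinuousAt (fun z : M × ℝ => Q (φ z.1, z.2)) (q, τ) :=
      ContinuousAt.comp (g := Q) (f := fun z : M × ℝ => (φ z.1, z.2)) hc h1
    exact ContinuousAt.comp (g := φ.symm) (f := fun z : M × ℝ => Q (φ z.1, z.2))
      (continuousAt_extChartAt_symm'' (hball _ hb).1) h2
  · obtain ⟨hqs, -, hq', -⟩ := hgood q hq τ hτ
    have h1 : F (φ q) = f q := by rw [hFdef, comp_apply, φ.left_inv hqs]
    rw [← h1]
    exact hq'
  · obtain ⟨hqs, -, -, hd, hb, hb'⟩ := hgood q hq τ hτ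
    simp only at hd hb hb'
    have h0 : φ.symm (φ q) = q := φ.left_inv hqs
    suffices h : edist (φ.symm (φ q)) (φ.symm (Q (φ q, τ))) ≤ ENNReal.ofReal (α⁻¹ * |τ|) by
      rwa [h0] at h
    refine edist_extChartAt_symm_le p fun z hz => ?_
    obtain ⟨hzt, hzw⟩ := hball z ((convex_ball _ _).segment_subset hb' hb hz)
    refine ⟨hzt, ?_⟩
    rcases eq_or_ne τ 0 with rfl | hτ0
    · have h2 : Q (φ q, 0) - φ q = 0 := by simpa using hd
      have h3 : mfderiv 𝓘(ℝ, E) 𝓘(ℝ, E) φ.symm z (Q (φ q, 0) - φ q) = 0 := by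
        rw [h2]; exact map_zero (mfderiv 𝓘(ℝ, E) 𝓘(ℝ, E) φ.symm z)
      rw [h3, enorm_zero]
      exact zero_le
    · -- the displacement is `τ` times a vector close to `v`
      set w : E := τ⁻¹ • (Q (φ q, τ) - φ q) with hw
      have hwe : Q (φ q, τ) - φ q = τ • w := by rw [hw, smul_inv_smul₀ hτ0]
      have hwb : w ∈ Metric.ball v ε := by
        rw [mem_ball_iff_norm]
        rw [hwe, ← smul_sub, norm_smul, Real.norm_eq_abs, mul_comm] at hd
        exact (le_of_mul_le_mul_right hd (abs_pos.2 hτ0)).trans_lt (half_lt_self hε)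
      have h3 := hzw w hwb
      have h4 : mfderiv 𝓘(ℝ, E) 𝓘(ℝ, E) φ.symm z (Q (φ q, τ) - φ q) =
          τ • mfderiv 𝓘(ℝ, E) 𝓘(ℝ, E) φ.symm z w := by
        rw [hwe]; exact map_smul (mfderiv 𝓘(ℝ, E) 𝓘(ℝ, E) φ.symm z) τ w
      rw [h4, ← ofReal_norm, norm_smul, Real.norm_eq_abs, mul_comm]
      exact ENNReal.ofReal_le_ofReal (mul_le_mul_of_nonneg_right h3.le (abs_nonneg _))

end Manifold

theorem lemma3
    {E : Type*} [NormedAddCommGroup E] [NormedSpace ℝ E] [FiniteDimensional ℝ E]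
    {M : Type*} [EMetricSpace M] [ChartedSpace E M] [IsManifold 𝓘(ℝ, E) ∞ M]
    [Bundle.RiemannianBundle (fun x : M => TangentSpace 𝓘(ℝ, E) x)]
    [IsContMDiffRiemannianBundle 𝓘(ℝ, E) ∞ E (fun x : M => TangentSpace 𝓘(ℝ, E) x)]
    [IsRiemannianManifold 𝓘(ℝ, E) M]
    (f : M → ℝ) (hf_nonneg : ∀ x, 0 ≤ f x) (hf_cont : Continuous f)
    (hf_smooth : ContMDiffOn 𝓘(ℝ, E) 𝓘(ℝ, ℝ) 2 f (f ⁻¹' {0})ᶜ)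
    (a : ℝ) (ha : 0 < a)
    (α : ℝ) (hα : 0 < α)
    (hf_grad : ∀ x ∈ (f ⁻¹' {0})ᶜ, α < ‖(riemannianGradient f x : TangentSpace 𝓘(ℝ, E) x)‖)
    (hf_compact : IsCompact (f ⁻¹' Set.Icc 0 a)) :
    IsStrongDeformationRetract (f ⁻¹' {0}) (f ⁻¹' Set.Icc 0 a) ∧
      IsStrongDeformationRetract (f ⁻¹' Set.Ici a) (f ⁻¹' {0})ᶜ := by
  have : IsManifold 𝓘(ℝ, E) 1 M := .of_le (n := ∞) (by norm_cast)
  have : IsContinuousRiemannianBundle E (fun x : M => TangentSpace 𝓘(ℝ, E) x) := by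
    obtain ⟨g, hg, hg'⟩ := ‹IsContMDiffRiemannianBundle 𝓘(ℝ, E) ∞ E
      (fun x : M => TangentSpace 𝓘(ℝ, E) x)›.exists_contMDiff
    exact ⟨g, hg.continuous, hg'⟩
  refine isStrongDeformationRetract_of_forall_isLevelPush hf_cont hf_nonneg (inv_nonneg.2 hα.le)
    ha hf_compact fun p hp => ?_
  have hpo : p ∈ (f ⁻¹' {0})ᶜ := hp.ne'
  have hopen : IsOpen (f ⁻¹' {0})ᶜ := (isClosed_singleton.preimage hf_cont).isOpen_compl
  exact exists_isLevelPush_of_lt_norm_riemannianGradient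
    (((hf_smooth p hpo).contMDiffAt (hopen.mem_nhds hpo)).of_le one_le_two) hα (hf_grad p hpo)
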